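/- Let $A$ be a finite alphabet. A two-way automaton over $A$ is a tuple $\mathcal{A} = (Z, A, \delta, X_0, F)$ with a finite set of states $Z = X \mathbin{\dot\cup} Y$ partitioned into right-moving states $X$ and left-moving states $Y$, initial states $X_0 \subseteq X$, final states $F \subseteq Z$, and transitions $$\delta \subseteq (Z \times A \times Z) \cup (Y \times \{\triangleright\} \times X) \cup (X \times \{\triangleleft\} \times Z),$$ where $\triangleright, \triangleleft \notin A$ are the left and right end markers. On input $u \in A^*$ the tape is $\triangleright u \triangleleft$, with $\triangleright$ at position $0$, the letters of $u$ at positions $1, \ldots, |u|$, and $\triangleleft$ at position $|u|+1$. If the head is at position $i$ labeled by $a$ and $(z,a,z') \in \delta$, then $\mathcal{A}$ may go from state $z$ to state $z'$, the head moving to $i+1$ if $z' \in X$ and to $i-1$ if $z' \in Y$. The word $u$ is accepted if some finite sequence of such steps leads from an initial state at position $1$ to a final state at position $|u|+2$, all configurations before the last one being at positions in $\{0, \ldots, |u|+1\}$. The language recognized by $\mathcal{A}$ is the set of accepted words. The automaton is deterministic if $|X_0| = 1$ and for all $z \in Z$ and $a \in A \cup \{\triangleright, \triangleleft\}$ there is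 at most one $z'$ with $(z,a,z') \in \delta$; the empty automaton ($Z = \emptyset$) also counts as deterministic. It is partially ordered if there is a partial order $\sqsubseteq$ on $Z$ such that $z \sqsubseteq z'$ whenever $(z,a,z') \in \delta$. It is one-pass if $(z, \triangleleft, z') \in \delta$ implies $z = z'$. Lemma. The class of languages $L \subseteq A^*$ recognizable by one-pass deterministic partially ordered two-way automata is a Boolean algebra: it contains $\emptyset$ and $A^*$ and is closed under union, intersection, and complementation in $A^*$. -/

import Mathlib

universe u v

/-- The symbols on the tape: the left end marker, the letters of the alphabet `A`,
and the right end marker. -/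
inductive TapeSymbol (A : Type u) : Type u
  | leftEnd : TapeSymbol A
  | letter : A → TapeSymbol A
  | rightEnd : TapeSymbol A

/-- A (nondeterministic) two-way automaton over the alphabet `A` with states `Z`.
The states are partitioned into the right-moving ones (`rightMoving`) and the left-moving
ones (the complement of `rightMoving`).  `step z a z'` says that `(z, a, z')` is a transition.
Finiteness of the set of states is required where automata are used to recognize languages. -/
structure TwoWayAutomaton (A : Type u) (Z : Type v) where
  rightMoving : Set Z
  step : Z → TapeSymbol A → Z → Prop
  start : Set Z
  accept : Set Z
  start_subset : start ⊆ rightMoving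
  /-- At the left end marker, transitions lead from left-moving to right-moving states. -/
  step_leftEnd : ∀ z z', step z .leftEnd z' → z ∉ rightMoving ∧ z' ∈ rightMoving
  /-- At the right end marker, transitions start in right-moving states. -/
  step_rightEnd : ∀ z z', step z .rightEnd z' → z ∈ rightMoving

namespace TwoWayAutomaton

variable {A : Type u} {Z : Type v}

/-- The tape content on input `w`: position `0` carries the left end marker, positions
`1, …, |w|` carry the letters of `w`, and position `|w| + 1` carries the right end marker. -/
def tape (w : List A) : List (TapeSymbol A) :=
  .leftEnd :: (w.map .letter ++ [.rightEnd])

/-- The one-step relation between configurations `(state, head position)` on input `w`.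
The direction of the head movement is determined by the destination state. No step is possible
from a position beyond `|w| + 1`, because such a position carries no symbol. -/
def Move (M : TwoWayAutomaton A Z) (w : List A) (c c' : Z × ℕ) : Prop :=
  ∃ a, (tape w)[c.2]? = some a ∧ M.step c.1 a c'.1 ∧
    ((c'.1 ∈ M.rightMoving ∧ c'.2 = c.2 + 1) ∨ (c'.1 ∉ M.rightMoving ∧ c'.2 + 1 = c.2))

/-- `w` is accepted if some finite sequence of steps leads from an initial state at position `1`
to a final state at position `|w| + 2`, i.e. just beyond the right end marker. (All
configurations before the last one are automatically at positions `0, …, |w| + 1`.) -/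
def Accepts (M : TwoWayAutomaton A Z) (w : List A) : Prop :=
  ∃ z₀ ∈ M.start, ∃ z ∈ M.accept,
    Relation.ReflTransGen (M.Move w) (z₀, 1) (z, w.length + 2)

/-- The language recognized by a two-way automaton. -/
def language (M : TwoWayAutomaton A Z) : Language A :=
  {w : List A | M.Accepts w}

/-- Exactly one initial state (or no states at all: the empty automaton counts as deterministic),
and at most one transition for every state and tape symbol. -/
def IsDeterministic (M : TwoWayAutomaton A Z) : Prop :=
  ((∃! z, z ∈ M.start) ∨ IsEmpty Z) ∧
    ∀ z a z₁ z₂, M.step z a z₁ → M.step z a z₂ → z₁ = z₂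

/-- A transition at the right end marker never changes the state. -/
def IsOnePass (M : TwoWayAutomaton A Z) : Prop :=
  ∀ z z', M.step z .rightEnd z' → z = z'

/-- There is a partial order on the states along which all transitions are non-descending. -/
def IsPartiallyOrdered (M : TwoWayAutomaton A Z) : Prop :=
  ∃ r : PartialOrder Z, ∀ z a z', M.step z a z' → r.le z z'

end TwoWayAutomaton

/-- `L` is recognized by some one-pass deterministic partially ordered two-way automaton
with finitely many states. -/
def IsOnePassPo2dfaRecognizable {A : Type u} (L : Language A) : Prop :=
  ∃ (Z : Type u) (_ : Finite Z) (M : TwoWayAutomaton A Z),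
    M.IsDeterministic ∧ M.IsPartiallyOrdered ∧ M.IsOnePass ∧ M.language = L

/-! Partial order and determinism let an automaton be unfolded into a finite tree, a `ScanProgram`:
self-loops become scans and every other transition descends to a subtree. One-pass means that
acceptance depends only on the program in which the right end is reached. Conversely the subprograms
of a tree are the states of an automaton ordered by height, so it suffices to combine the outputs of
two programs (`ScanProgram.exists_combine`).

Let P₁ and P₂ have reached right-moving programs x₁ and x₂ at the end of a prefix u. Both stay
unchanged until the first letter a that changes x₁ or x₂; if none comes, the output is `op x₁.out
x₂.out`. Otherwise the head rewinds, reruns P₁ on the prefix ending in a, rewinds, and reruns P₂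
there, obtaining y₁ and y₂ of smaller total height; induction on that sum continues from the end of
the prefix (`exists_combine_from`).

The difficulty is to rerun P on a prefix whose end is not marked. The prefix is described as the
first hit of a set of states of a monotone one-way machine F, and `exists_relativizes` tracks F
during the simulation of P. Rightward moves change the state of F only finitely often. A leftward
scan for a set C needs the state F had before the last letter in C, so `remember` stores it for
every C. Each nested left scan uses up one layer of memory, and the height of P bounds the layers
needed. -/

noncomputable section

open scoped Classical

/-! ### Scan programs and their runs -/

/-- A loop-free program for a head on a word. A program `right out exits next` scans to the right
for the first letter `a ∈ exits` and continues with `next a`; `out` is its output if it meets the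
right end instead. A program `left exits next atLeft` scans to the left for the first letter
`a ∈ exits` and continues with `next a`, or with `atLeft` if it meets the left end. -/
inductive ScanProgram (A : Type u) : Type u
  | right (out : Bool) (exits : Set A) (next : exits → ScanProgram A) : ScanProgram A
  | left (exits : Set A) (next : exits → ScanProgram A) (atLeft : ScanProgram A) : ScanProgram A

namespace ScanProgram

variable {A : Type u}

/-- The program scans to the right. -/
def IsRight : ScanProgram A → Prop
  | right _ _ _ => True
  | left _ _ _ => False

theorem isRight_right {v : Bool} {exits : Set A} {f : exits → ScanProgram A} :
    (right v exits f).IsRight := trivial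

theorem not_isRight_left {exits : Set A} {f : exits → ScanProgram A} {q : ScanProgram A} :
    ¬ (left exits f q).IsRight := id

/-- The output of a program that meets the right end. -/
def out : ScanProgram A → Bool
  | right v _ _ => v
  | left _ _ _ => false

/-- The program that scans to the right end and outputs `v`. -/
def halt (v : Bool) : ScanProgram A := right v ∅ fun a => a.2.elim

/-- The program that moves to the left end and continues there with `P`. -/
def rewind (P : ScanProgram A) : ScanProgram A := left ∅ (fun a => a.2.elim) P

/-- The program that continues after a letter has been read. -/
def next : ScanProgram A → A → ScanProgram A
  | right v exits f, a => if h : a ∈ exits then f ⟨a, h⟩ else right v exits f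
  | left exits f q, a => if h : a ∈ exits then f ⟨a, h⟩ else left exits f q

/-- The program that continues when the head is at the left end. -/
def bounce : ScanProgram A → ScanProgram A
  | right v exits f => right v exits f
  | left _ _ q => bounce q

theorem isRight_bounce : ∀ P : ScanProgram A, P.bounce.IsRight
  | right _ _ _ => trivial
  | left _ _ q => isRight_bounce q

theorem bounce_of_isRight : ∀ {P : ScanProgram A}, P.IsRight → P.bounce = P
  | right _ _ _, _ => rfl

/-- The behaviour of a scan to the right. The letters to the left of the head are listed in
reverse order. -/
def scanRight {β : Type u} (exits : Set A) (found : exits → List A → List A → β) (atEnd : β) :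
    List A → List A → β
  | _, [] => atEnd
  | l, a :: r => if h : a ∈ exits then found ⟨a, h⟩ l r else scanRight exits found atEnd (a :: l) r

/-- The behaviour of a scan to the left. The letters to the left of the head are listed in
reverse order. -/
def scanLeft {β : Type u} (exits : Set A) (found : exits → List A → List A → β)
    (atEnd : List A → β) : List A → List A → β
  | [], r => atEnd r
  | a :: l, r => if h : a ∈ exits then found ⟨a, h⟩ l r else scanLeft exits found atEnd l (a :: r)

/-- The program in which the right end is reached when `P` is started with the letters of `l`, in
reverse order, to the left of the head and with those of `r` to its right. -/
def run : ScanProgram A → List A → List A → ScanProgram A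
  | right v exits f => scanRight exits (fun a l r =>
      if (f a).IsRight then run (f a) (a :: l) r else run (f a) l (a :: r)) (right v exits f)
  | left exits f q => scanLeft exits (fun a l r =>
      if (f a).IsRight then run (f a) (a :: l) r else run (f a) l (a :: r)) (fun r => run q [] r)

/-- The result of entering `P` after reading `a` between `l` and `r`. -/
def resume (P : ScanProgram A) (l : List A) (a : A) (r : List A) : ScanProgram A :=
  if P.IsRight then run P (a :: l) r else run P l (a :: r)

theorem resume_of_isRight {P : ScanProgram A} (h : P.IsRight) (l : List A) (a : A) (r : List A) :
    P.resume l a r = P.run (a :: l) r := if_pos h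

theorem resume_of_not_isRight {P : ScanProgram A} (h : ¬ P.IsRight) (l : List A) (a : A)
    (r : List A) : P.resume l a r = P.run l (a :: r) := if_neg h

theorem run_nil : ∀ {P : ScanProgram A}, P.IsRight → ∀ l, P.run l [] = P
  | right _ _ _, _, l => by cases l <;> rfl

theorem run_cons : ∀ {P : ScanProgram A}, P.IsRight → ∀ l a r,
    P.run l (a :: r) = (P.next a).resume l a r
  | right v exits f, _, l, a, r => by
    by_cases h : a ∈ exits
    · simp [run, scanRight, next, h, resume]
    · simp [run, scanRight, next, h, resume, IsRight]

theorem run_left_cons : ∀ {P : ScanProgram A}, ¬ P.IsRight → ∀ l a r,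
    P.run (a :: l) r = (P.next a).resume l a r
  | right _ _ _, h, _, _, _ => (h trivial).elim
  | left exits f q, _, l, a, r => by
    by_cases h : a ∈ exits
    · simp [run, scanLeft, next, h, resume]
    · simp [run, scanLeft, next, h, resume, IsRight]

theorem run_left_nil : ∀ (P : ScanProgram A) r, P.run [] r = P.bounce.run [] r
  | right _ _ _, _ => rfl
  | left exits f q, r => by
    rw [bounce, ← run_left_nil q r]
    rfl

theorem run_rewind (P : ScanProgram A) (l r : List A) :
    (rewind P).run l r = P.run [] (l.reverse ++ r) := by
  induction l generalizing r with
  | nil => rfl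
  | cons a l ih =>
    have h : (rewind P).run (a :: l) r = (rewind P).run l (a :: r) := by
      simp [rewind, run, scanLeft]
    rw [h, ih]
    simp

theorem not_isRight_rewind (P : ScanProgram A) : ¬ (rewind P).IsRight := id

theorem resume_rewind (P : ScanProgram A) (l : List A) (a : A) (r : List A) :
    (rewind P).resume l a r = P.run [] ((a :: l).reverse ++ r) := by
  rw [resume_of_not_isRight (not_isRight_rewind P), run_rewind]
  simp

theorem next_halt (v : Bool) (a : A) : (halt v).next a = halt v := by
  simp [halt, next]

theorem run_halt (v : Bool) (l r : List A) : (halt v).run l r = halt v := by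
  induction r generalizing l with
  | nil => exact run_nil (P := halt v) trivial l
  | cons a r ih =>
    rw [run_cons (P := halt v) trivial, next_halt, resume_of_isRight (P := halt v) trivial, ih]

/-- Induction along the run of a program. -/
theorem run_induction {motive : ScanProgram A → List A → List A → Prop}
    (right_nil : ∀ P l, P.IsRight → motive P l [])
    (right_cons : ∀ P l a r, P.IsRight →
      ((P.next a).IsRight → motive (P.next a) (a :: l) r) →
      (¬ (P.next a).IsRight → motive (P.next a) l (a :: r)) → motive P l (a :: r))
    (left_nil : ∀ P r, ¬ P.IsRight → motive P.bounce [] r → motive P [] r)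
    (left_cons : ∀ P l a r, ¬ P.IsRight →
      ((P.next a).IsRight → motive (P.next a) (a :: l) r) →
      (¬ (P.next a).IsRight → motive (P.next a) l (a :: r)) → motive P (a :: l) r)
    (P : ScanProgram A) (l r : List A) : motive P l r := by
  -- `bounce` may skip several levels of left programs, so its case is carried along in the
  -- induction.
  suffices h : (∀ l r, motive P l r) ∧ ∀ r, motive P.bounce [] r from h.1 l r
  clear l r
  induction P with
  | right v exits f ih =>
    suffices h : ∀ r l, motive (right v exits f) l r from ⟨fun l r => h r l, fun r => h r []⟩
    intro r
    induction r with
    | nil => exact fun l => right_nil _ l trivial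
    | cons a r ihr =>
      intro l
      by_cases h : a ∈ exits
      · have hn : (right v exits f).next a = f ⟨a, h⟩ := dif_pos h
        refine right_cons _ l a r trivial ?_ ?_ <;> rw [hn] <;> intro _ <;>
          exact (ih ⟨a, h⟩).1 _ _
      · have hn : (right v exits f).next a = right v exits f := dif_neg h
        refine right_cons _ l a r trivial ?_ ?_ <;> rw [hn] <;> intro h'
        · exact ihr _
        · exact (h' trivial).elim
  | left exits f q ih ihq =>
    refine ⟨fun l => ?_, ihq.2⟩
    induction l with
    | nil => exact fun r => left_nil _ r id (ihq.2 r)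
    | cons a l ihl =>
      intro r
      by_cases h : a ∈ exits
      · have hn : (left exits f q).next a = f ⟨a, h⟩ := dif_pos h
        refine left_cons _ l a r id ?_ ?_ <;> rw [hn] <;> intro _ <;>
          exact (ih ⟨a, h⟩).1 _ _
      · have hn : (left exits f q).next a = left exits f q := dif_neg h
        refine left_cons _ l a r id ?_ ?_ <;> rw [hn] <;> intro h'
        · exact h'.elim
        · exact ihl _

theorem isRight_run (P : ScanProgram A) (l r : List A) : (P.run l r).IsRight := by
  induction P, l, r using run_induction with
  | right_nil P l h => rwa [run_nil h]
  | right_cons P l a r h h₁ h₂ =>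
    rw [run_cons h, resume]
    split_ifs with h'
    exacts [h₁ h', h₂ h']
  | left_nil P r h h₁ => rwa [run_left_nil]
  | left_cons P l a r h h₁ h₂ =>
    rw [run_left_cons h, resume]
    split_ifs with h'
    exacts [h₁ h', h₂ h']

/-- A run on a word passes through the final configuration of the run on a prefix. -/
theorem run_append (P : ScanProgram A) (l r s : List A) :
    P.run l (r ++ s) = (P.run l r).run (r.reverse ++ l) s := by
  induction P, l, r using run_induction with
  | right_nil P l h => simp [run_nil h]
  | right_cons P l a r h h₁ h₂ =>
    rw [List.cons_append, run_cons h, run_cons h, resume, resume]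
    split_ifs with h'
    · simpa using h₁ h'
    · simpa using h₂ h'
  | left_nil P r h h₁ => rwa [run_left_nil, run_left_nil P]
  | left_cons P l a r h h₁ h₂ =>
    rw [run_left_cons h, run_left_cons h, resume, resume]
    split_ifs with h'
    · simpa using h₁ h'
    · simpa using h₂ h'

theorem run_eq_self {P : ScanProgram A} (hP : P.IsRight) {r : List A}
    (h : ∀ a ∈ r, P.next a = P) (l : List A) : P.run l r = P := by
  induction r generalizing l with
  | nil => exact run_nil hP l
  | cons a r ih =>
    rw [run_cons hP, h a List.mem_cons_self, resume_of_isRight hP]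
    exact ih (fun b hb => h b (List.mem_cons_of_mem a hb)) _

/-! ### Height as a measure of progress -/

/-- The nesting depth of a program. -/
def height : ScanProgram A → ℕ
  | right _ _ f => (⨆ a, height (f a)) + 1
  | left _ f q => max (⨆ a, height (f a)) (height q) + 1

theorem height_bounce_le : ∀ P : ScanProgram A, P.bounce.height ≤ P.height
  | right _ _ _ => le_rfl
  | left _ _ q => (height_bounce_le q).trans ((le_max_right _ _).trans (Nat.le_succ _))

theorem height_bounce_lt : ∀ {P : ScanProgram A}, ¬ P.IsRight → P.bounce.height < P.height
  | right _ _ _, h => (h trivial).elim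
  | left _ _ q, _ => Nat.lt_succ_of_le ((height_bounce_le q).trans (le_max_right _ _))

theorem height_lt_atLeft {exits : Set A} (f : exits → ScanProgram A) (q : ScanProgram A) :
    q.height < (left exits f q).height :=
  Nat.lt_succ_of_le (le_max_right _ _)

theorem height_pos : ∀ P : ScanProgram A, 0 < P.height
  | right _ _ _ => Nat.succ_pos _
  | left _ _ _ => Nat.succ_pos _

variable [Finite A]

theorem height_lt_right {v : Bool} {exits : Set A} (f : exits → ScanProgram A) (a : exits) :
    (f a).height < (right v exits f).height :=
  Nat.lt_succ_of_le (le_ciSup (f := fun a => (f a).height) (Set.finite_range _).bddAbove a)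

theorem height_lt_left {exits : Set A} (f : exits → ScanProgram A) (q : ScanProgram A) (a : exits) :
    (f a).height < (left exits f q).height :=
  Nat.lt_succ_of_le ((le_ciSup (f := fun a => (f a).height) (Set.finite_range _).bddAbove a).trans
    (le_max_left _ _))

theorem next_eq_or_height_lt :
    ∀ (P : ScanProgram A) (a : A), P.next a = P ∨ (P.next a).height < P.height
  | right v exits f, a => by
    by_cases h : a ∈ exits
    · right
      rw [next, dif_pos h]
      exact height_lt_right f _
    · exact Or.inl (dif_neg h)
  | left exits f q, a => by
    by_cases h : a ∈ exits
    · right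
      rw [next, dif_pos h]
      exact height_lt_left f q _
    · exact Or.inl (dif_neg h)

theorem height_next_le (P : ScanProgram A) (a : A) : (P.next a).height ≤ P.height := by
  rcases P.next_eq_or_height_lt a with h | h
  · rw [h]
  · exact h.le

theorem height_run_le (P : ScanProgram A) (l r : List A) : (P.run l r).height ≤ P.height := by
  induction P, l, r using run_induction with
  | right_nil P l h => rw [run_nil h]
  | right_cons P l a r h h₁ h₂ =>
    rw [run_cons h, resume]
    split_ifs with h'
    exacts [(h₁ h').trans (P.height_next_le a), (h₂ h').trans (P.height_next_le a)]
  | left_nil P r h h₁ =>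
    rw [run_left_nil]
    exact h₁.trans P.height_bounce_le
  | left_cons P l a r h h₁ h₂ =>
    rw [run_left_cons h, resume]
    split_ifs with h'
    exacts [(h₁ h').trans (P.height_next_le a), (h₂ h').trans (P.height_next_le a)]

end ScanProgram

/-! ### Monotone prefix machines, their memory and first hits -/

/-- A one-way deterministic automaton whose states never decrease. -/
structure PrefixMachine (A : Type u) where
  State : Type u
  [partialOrder : PartialOrder State]
  [finite : Finite State]
  init : State
  step : State → A → State
  le_step : ∀ s a, s ≤ step s a

namespace PrefixMachine

attribute [instance] PrefixMachine.partialOrder PrefixMachine.finite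

variable {A : Type u}

/-- The state after reading the letters of a list in reverse order. -/
def eval (F : PrefixMachine A) : List A → F.State
  | [] => F.init
  | a :: l => F.step (eval F l) a

/-- The machine that also remembers, for each set `C` of letters, the state before the last letter
in `C`. -/
def remember [Finite A] (F : PrefixMachine A) : PrefixMachine A where
  State := {p : F.State × (Set A → F.State) // ∀ C, p.2 C ≤ p.1}
  init := ⟨(F.init, fun _ => F.init), fun _ => le_rfl⟩
  step p a := ⟨(F.step p.1.1 a, fun C => if a ∈ C then p.1.1 else p.1.2 C), fun C => by
    dsimp only
    split_ifs
    · exact F.le_step _ _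
    · exact (p.2 C).trans (F.le_step _ _)⟩
  le_step p a := by
    -- A stored state is only ever overwritten by the current one; the subtype condition makes this
    -- an increase.
    refine Subtype.mk_le_mk.2 (Prod.mk_le_mk.2 ⟨F.le_step _ _, fun C => ?_⟩)
    dsimp only
    split_ifs
    · exact p.2 C
    · exact le_rfl

/-- Iterated remembering. -/
def memory [Finite A] (F : PrefixMachine A) : ℕ → PrefixMachine A
  | 0 => F
  | n + 1 => (memory F n).remember

/-- The state of the original machine. -/
def forget [Finite A] (F : PrefixMachine A) : ∀ n, (F.memory n).State → F.State
  | 0, s => s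
  | n + 1, s => forget F n s.1.1

theorem eval_remember_fst [Finite A] (F : PrefixMachine A) (l : List A) :
    (F.remember.eval l).1.1 = F.eval l := by
  induction l with
  | nil => rfl
  | cons a l ih => exact congrArg (F.step · a) ih

theorem eval_remember_snd_cons [Finite A] (F : PrefixMachine A) (a : A) (l : List A) (C : Set A) :
    (F.remember.eval (a :: l)).1.2 C =
      if a ∈ C then F.eval l else (F.remember.eval l).1.2 C := by
  rw [← eval_remember_fst F l]
  rfl

theorem forget_eval [Finite A] (F : PrefixMachine A) (n : ℕ) (l : List A) :
    F.forget n ((F.memory n).eval l) = F.eval l := by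
  induction n with
  | zero => rfl
  | succ n ih => exact (congrArg (F.forget n) (eval_remember_fst _ l)).trans ih

/-- `l` is the shortest of its suffixes that leads to a state in `T`. -/
def FirstHit (F : PrefixMachine A) (T : Set F.State) (l : List A) : Prop :=
  F.eval l ∈ T ∧ ∀ l', l' <:+ l → l' ≠ l → F.eval l' ∉ T

/-- The machine that detects the first letter in `B` that is read in a state in `T`. -/
def detect (F : PrefixMachine A) (T : Set F.State) (B : Set A) : PrefixMachine A where
  State := F.State × ULift.{u} Bool
  init := (F.init, ⟨false⟩)
  step p a := (F.step p.1 a, ⟨p.2.down || (decide (p.1 ∈ T) && decide (a ∈ B))⟩)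
  le_step p a := Prod.mk_le_mk.2 ⟨F.le_step _ _, by
    change p.2.down ≤ _
    cases p.2.down <;> simp⟩

theorem eval_detect_fst (F : PrefixMachine A) (T : Set F.State) (B : Set A) (l : List A) :
    ((F.detect T B).eval l).1 = F.eval l := by
  induction l with
  | nil => rfl
  | cons a l ih => exact congrArg (F.step · a) ih

theorem eval_detect_snd_cons (F : PrefixMachine A) (T : Set F.State) (B : Set A) (a : A)
    (l : List A) : ((F.detect T B).eval (a :: l)).2.down =
      (((F.detect T B).eval l).2.down || (decide (F.eval l ∈ T) && decide (a ∈ B))) := by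
  rw [← eval_detect_fst F T B]
  rfl

theorem eval_mono (F : PrefixMachine A) {l l' : List A} (h : l' <:+ l) : F.eval l' ≤ F.eval l := by
  obtain ⟨m, rfl⟩ := h
  induction m with
  | nil => exact le_rfl
  | cons a m ih => exact ih.trans (F.le_step _ _)

theorem eval_detect_snd_of_forall_notMem (F : PrefixMachine A) (T : Set F.State) (B : Set A) :
    ∀ l : List A, (∀ l', l' <:+ l → l' ≠ l → F.eval l' ∉ T) →
      ((F.detect T B).eval l).2.down = false
  | [], _ => rfl
  | a :: l, h => by
    have hl : F.eval l ∉ T := h l (List.suffix_cons a l) fun h => by simpa using congrArg List.length h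
    have ih := eval_detect_snd_of_forall_notMem F T B l fun l' h₁ h₂ =>
      h l' (h₁.trans (List.suffix_cons a l)) fun h => by
        have := h₁.length_le
        rw [h] at this
        simp at this
    rw [eval_detect_snd_cons, ih]
    simp [hl]

/-- Before the end of `u` the machine is outside `T`, and from there on it stays in the upper set
`T`. Hence detection ignores letters of `B` inside `u` and fires at the first one after it, which is
`a`. -/
theorem FirstHit.detect {F : PrefixMachine A} {T : Set F.State} (hT : IsUpperSet T) {u : List A}
    (hu : F.FirstHit T u) {B : Set A} {m : List A} (hm : ∀ b ∈ m, b ∉ B) {a : A} (ha : a ∈ B) :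
    (F.detect T B).FirstHit {p | p.2.down = true} (a :: (m ++ u)) := by
  have h : ((F.detect T B).eval (m ++ u)).2.down = false := by
    induction m with
    | nil => exact eval_detect_snd_of_forall_notMem F T B u hu.2
    | cons b m ih =>
      rw [List.cons_append, eval_detect_snd_cons, ih fun c hc => hm c (List.mem_cons_of_mem b hc)]
      simp [hm b List.mem_cons_self]
  refine ⟨?_, fun l' h₁ h₂ h₃ => ?_⟩
  · have hmem : F.eval (m ++ u) ∈ T := hT (F.eval_mono (List.suffix_append m u)) hu.1
    rw [Set.mem_ofPred_eq, eval_detect_snd_cons]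
    simp [hmem, ha]
  · rcases List.suffix_cons_iff.1 h₁ with h₄ | h₄
    · exact h₂ h₄
    · have h₅ : ((F.detect T B).eval l').2.down ≤ ((F.detect T B).eval (m ++ u)).2.down :=
        (Prod.mk_le_mk.1 ((F.detect T B).eval_mono h₄)).2
      rw [Set.mem_ofPred_eq] at h₃
      rw [h, h₃] at h₅
      exact absurd h₅ (by decide)

theorem isUpperSet_detect (F : PrefixMachine A) (T : Set F.State) (B : Set A) :
    IsUpperSet {p : (F.detect T B).State | p.2.down = true} := by
  intro p q hpq hp
  have h : p.2.down ≤ q.2.down := (Prod.mk_le_mk.1 hpq).2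
  rw [Set.mem_ofPred_eq] at hp ⊢
  rw [hp] at h
  exact top_le_iff.1 h

end PrefixMachine

/-! ### Simulating a program on an unmarked prefix -/

namespace ScanProgram

variable {A : Type u} [Finite A]

open PrefixMachine

/-- The program `R`, started in a position where `F.memory n` is in the state `d`, simulates `P` on
the shortest prefix that leads `F` to `T`, and then continues with `K` of the resulting program. -/
structure Relativizes (F : PrefixMachine A) (T : Set F.State)
    (K : ScanProgram A → ScanProgram A) (P : ScanProgram A) (n : ℕ) (d : (F.memory n).State)
    (R : ScanProgram A) : Prop where
  isRight_iff : R.IsRight ↔ P.IsRight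
  run_eq : ∀ l r u a s, (F.memory n).eval l = d → r ≠ [] → r.reverse ++ l = a :: u →
    F.FirstHit T (a :: u) → R.run l (r ++ s) = (K (P.run l r)).resume u a s

/-- The simulating scan also stops at letters that change the tracked state `d`. Each such change
strictly increases `d` in a finite order, so an inner induction on `d` keeps the program tree
finite. -/
theorem exists_relativizes_right (F : PrefixMachine A) (T : Set F.State)
    (K : ScanProgram A → ScanProgram A) (v : Bool) (exits : Set A) (f : exits → ScanProgram A)
    (n : ℕ) (ih : ∀ a d, ∃ R, Relativizes F T K (f a) n d R) (d : (F.memory n).State) :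
    ∃ R, Relativizes F T K (right v exits f) n d R := by
  induction d using WellFoundedGT.induction with
  | ind d ihd =>
  have key : ∀ a : {a | a ∈ exits ∨ (F.memory n).step d a ≠ d}, ∃ R : ScanProgram A,
      ∀ l r u b s, (F.memory n).eval l = d → (a.1 :: r).reverse ++ l = b :: u →
        F.FirstHit T (b :: u) →
          R.resume l a (r ++ s) = (K ((right v exits f).run l (a :: r))).resume u b s := by
    rintro ⟨a, ha⟩
    by_cases hr : ((right v exits f).next a).IsRight
    · by_cases hc : F.forget n ((F.memory n).step d a) ∈ T
      -- Reading `a` takes `F` into `T`, so by minimality `a` is the last letter of the prefix: `r`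
      -- is empty and control passes to `K`.
      · refine ⟨K ((right v exits f).next a), fun l r u b s hl hu hT => ?_⟩
        have hF : F.eval (a :: l) ∈ T := by
          rw [← F.forget_eval n, eval, hl]
          exact hc
        have hs : a :: l = b :: u := by
          by_contra hne
          refine hT.2 (a :: l) ?_ hne hF
          rw [← hu]
          simp
        have hr' : r = [] := by
          have := congrArg List.length hu
          rw [← hs] at this
          simpa using this
        subst hr'
        obtain ⟨rfl, rfl⟩ := List.cons.inj hs
        dsimp only
        rw [run_cons isRight_right, resume_of_isRight hr, run_nil hr]
        rfl
      -- The prefix goes on past `a`. Either the simulated program descends to a subprogram, or it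
      -- stays the same and the tracked state grows.
      · have hQ : ∃ R, Relativizes F T K ((right v exits f).next a) n ((F.memory n).step d a) R := by
          by_cases h : a ∈ exits
          · rw [next, dif_pos h]
            exact ih _ _
          · rw [next, dif_neg h]
            exact ihd _ (lt_of_le_of_ne ((F.memory n).le_step d a) (ha.resolve_left h).symm)
        obtain ⟨R, hR⟩ := hQ
        refine ⟨R, fun l r u b s hl hu hT => ?_⟩
        dsimp only at hu ⊢
        rw [run_cons isRight_right, resume_of_isRight hr, resume_of_isRight (hR.isRight_iff.2 hr)]
        have he : (F.memory n).eval (a :: l) = (F.memory n).step d a := by rw [eval, hl]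
        refine hR.run_eq (a :: l) r u b s he ?_ (by simpa using hu) hT
        rintro rfl
        apply hc
        rw [← he, forget_eval]
        have h := hT.1
        rw [← hu] at h
        exact h
    -- On turning left the head stays before `a`, so the tracked state is still `d`.
    · have h : a ∈ exits := by
        by_contra h
        rw [next, dif_neg h] at hr
        exact hr trivial
      obtain ⟨R, hR⟩ := ih ⟨a, h⟩ d
      have hn : (right v exits f).next a = f ⟨a, h⟩ := dif_pos h
      rw [hn] at hr
      refine ⟨R, fun l r u b s hl hu hT => ?_⟩
      dsimp only at hu ⊢
      rw [run_cons isRight_right, hn, resume_of_not_isRight hr,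
        resume_of_not_isRight (mt hR.isRight_iff.1 hr)]
      exact hR.run_eq l (a :: r) u b s hl (List.cons_ne_nil _ _) hu hT
  choose g hg using key
  -- The output `false` is a dummy: the scan exits no later than the last letter of the prefix, as
  -- that letter changes the state of `F`.
  refine ⟨right false _ g, iff_of_true trivial trivial, fun l r => ?_⟩
  induction r generalizing l with
  | nil => exact fun _ _ _ _ h => (h rfl).elim
  | cons a r ihr =>
    intro u b s hl _ hu hT
    rw [List.cons_append, run_cons isRight_right]
    by_cases ha : a ∈ {a | a ∈ exits ∨ (F.memory n).step d a ≠ d}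
    · rw [next, dif_pos ha]
      exact hg ⟨a, ha⟩ l r u b s hl hu hT
    · rw [next, dif_neg ha, resume_of_isRight isRight_right]
      obtain ⟨h₁, h₂⟩ := not_or.1 ha
      rw [not_not] at h₂
      have he : (F.memory n).eval (a :: l) = d := by rw [eval, hl, h₂]
      rw [run_cons isRight_right, next, dif_neg h₁, resume_of_isRight isRight_right]
      refine ihr (a :: l) u b s he ?_ (by simpa using hu) hT
      -- If `a` ended the prefix, `F` would be in `T` already before reading it, since the tracked
      -- state is unchanged; this contradicts minimality.
      rintro rfl
      have hu' : a :: l = b :: u := hu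
      refine hT.2 l ?_ ?_ ?_
      · rw [← hu']
        exact List.suffix_cons a l
      · rw [← hu']
        intro h
        simpa using congrArg List.length h
      · rw [← F.forget_eval n, hl, ← he, forget_eval, hu']
        exact hT.1

/-- For a left scan the top layer of memory gives the lower-layer state before the letter where the
scan will stop. The subprograms are then simulated with one layer less, which suffices because their
height is smaller. -/
theorem exists_relativizes (F : PrefixMachine A) (T : Set F.State)
    (K : ScanProgram A → ScanProgram A) (P : ScanProgram A) (n : ℕ) (hn : P.height ≤ n)
    (d : (F.memory n).State) : ∃ R, Relativizes F T K P n d R := by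
  induction P generalizing n with
  | right v exits f ih =>
    exact exists_relativizes_right F T K v exits f n
      (fun a d => ih a n ((height_lt_right f a).le.trans hn) d) d
  | left exits f q ih ihq =>
    obtain _ | n := n
    · exact absurd hn (height_pos _).not_ge
    -- A right-moving continuation starts after `a`, so the remembered state must be advanced by
    -- `a`; a left-moving one starts before `a`.
    have key : ∀ a : exits, ∃ R, Relativizes F T K (f a) n
        (if (f a).IsRight then (F.memory n).step (d.1.2 exits) a else d.1.2 exits) R := fun a =>
      ih a n (Nat.lt_succ_iff.1 ((height_lt_left f q a).trans_le hn)) _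
    choose g hg using key
    obtain ⟨Rq, hq⟩ :=
      ihq n (Nat.lt_succ_iff.1 ((height_lt_atLeft f q).trans_le hn)) (F.memory n).init
    refine ⟨left exits g Rq, Iff.rfl, fun l r u b s hl => ?_⟩
    -- Only this component of the memory is invariant while the head moves left over letters outside
    -- `exits`, so the full hypothesis on `l` is dropped.
    have hl' : ((F.memory n).remember.eval l).1.2 exits = d.1.2 exits := by
      rw [← hl]
      rfl
    clear hl
    induction l generalizing r with
    | nil =>
      intro hr hu hT
      exact hq.run_eq [] r u b s rfl hr hu hT
    | cons c l ihl =>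
      intro hr hu hT
      rw [run_left_cons not_isRight_left, run_left_cons not_isRight_left]
      rw [eval_remember_snd_cons] at hl'
      by_cases hc : c ∈ exits
      · rw [if_pos hc] at hl'
        rw [next, next, dif_pos hc, dif_pos hc]
        have h := hg ⟨c, hc⟩
        by_cases hd : (f ⟨c, hc⟩).IsRight
        · rw [if_pos hd] at h
          rw [resume_of_isRight hd, resume_of_isRight (h.isRight_iff.2 hd)]
          refine h.run_eq (c :: l) r u b s ?_ hr hu hT
          rw [eval, hl']
        · rw [if_neg hd] at h
          rw [resume_of_not_isRight hd, resume_of_not_isRight (mt h.isRight_iff.1 hd)]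
          exact h.run_eq l (c :: r) u b s hl' (List.cons_ne_nil _ _) (by simpa using hu) hT
      · rw [if_neg hc] at hl'
        rw [next, next, dif_neg hc, dif_neg hc, resume_of_not_isRight (P := left exits g Rq) id,
          resume_of_not_isRight (P := left exits f q) id]
        exact ihl (c :: r) hl' (List.cons_ne_nil _ _) (by simpa using hu) hT

theorem height_run_singleton_le {P : ScanProgram A} (hP : P.IsRight) (l : List A) (a : A) :
    (P.run l [a]).height ≤ (P.next a).height := by
  rw [run_cons hP, resume]
  split_ifs <;> exact height_run_le _ _ _

/-- A letter that changes a program strictly lowers its height, and any excursion to the left before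
passing that letter cannot raise it again. -/
theorem height_run_singleton_add_lt {P₁ P₂ : ScanProgram A} (h₁ : P₁.IsRight) (h₂ : P₂.IsRight)
    {a : A} (ha : P₁.next a ≠ P₁ ∨ P₂.next a ≠ P₂) (l : List A) :
    (P₁.run l [a]).height + (P₂.run l [a]).height < P₁.height + P₂.height := by
  have h₃ := height_run_singleton_le h₁ l a
  have h₄ := height_run_singleton_le h₂ l a
  have h₅ := P₁.height_next_le a
  have h₆ := P₂.height_next_le a
  rcases ha with h | h
  · have := (P₁.next_eq_or_height_lt a).resolve_left h
    omega
  · have := (P₂.next_eq_or_height_lt a).resolve_left h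
    omega

/-! ### Simultaneous simulation of two programs -/

/-- The simultaneous simulation of `P₁` and `P₂`, from the moment where they have reached the
programs `x₁` and `x₂` at the end of the shortest prefix that leads `F` to `T`. -/
theorem exists_combine_from (op : Bool → Bool → Bool) (P₁ P₂ : ScanProgram A) (k : ℕ) :
    ∀ x₁ x₂ : ScanProgram A, x₁.IsRight → x₂.IsRight → x₁.height + x₂.height < k →
    ∀ (F : PrefixMachine A) (T : Set F.State), IsUpperSet T →
      ∃ R : ScanProgram A, R.IsRight ∧ ∀ u, F.FirstHit T u → P₁.run [] u.reverse = x₁ →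
        P₂.run [] u.reverse = x₂ →
          ∀ s, (R.run u s).out = op (x₁.run u s).out (x₂.run u s).out := by
  induction k with
  | zero => exact fun _ _ _ _ h => (Nat.not_lt_zero _ h).elim
  | succ k ihk =>
    intro x₁ x₂ hx₁ hx₂ hk F T hT
    set B : Set A := {a | x₁.next a ≠ x₁ ∨ x₂.next a ≠ x₂}
    -- Continuations must be total functions of `y₁` and `y₂`, hence a dummy where the induction
    -- hypothesis does not apply.
    have h₀ : ∀ y₁ y₂ : ScanProgram A, ∃ R : ScanProgram A,
        y₁.IsRight → y₂.IsRight → y₁.height + y₂.height < x₁.height + x₂.height →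
        R.IsRight ∧ ∀ u, (F.detect T B).FirstHit {p | p.2.down = true} u →
          P₁.run [] u.reverse = y₁ → P₂.run [] u.reverse = y₂ →
            ∀ s, (R.run u s).out = op (y₁.run u s).out (y₂.run u s).out := by
      intro y₁ y₂
      by_cases h : y₁.IsRight ∧ y₂.IsRight ∧ y₁.height + y₂.height < x₁.height + x₂.height
      · obtain ⟨R, hR⟩ := ihk y₁ y₂ h.1 h.2.1 (h.2.2.trans_le (Nat.lt_succ_iff.1 hk))
          (F.detect T B) _ (F.isUpperSet_detect T B)
        exact ⟨R, fun _ _ _ => hR⟩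
      · exact ⟨halt false, fun h₁ h₂ h₃ => (h ⟨h₁, h₂, h₃⟩).elim⟩
    choose G hG using h₀
    -- The result `y₁` of rerunning `P₁` is kept in the choice of continuation: `G₂ y₁` reruns `P₂`
    -- and then enters `G y₁ y₂`. Both reruns start at the left end, with the memory in its initial
    -- state.
    choose G₂ hG₂ using fun y₁ => exists_relativizes (F.detect T B) {p | p.2.down = true} (G y₁)
      P₂ P₂.height le_rfl (PrefixMachine.init _)
    obtain ⟨R₁, hR₁⟩ := exists_relativizes (F.detect T B) {p | p.2.down = true}
      (fun y₁ => rewind (G₂ y₁)) P₁ P₁.height le_rfl (PrefixMachine.init _)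
    refine ⟨right (op x₁.out x₂.out) B fun _ => rewind R₁, trivial, fun u hu hu₁ hu₂ s => ?_⟩
    -- Here `m` holds, in reverse order, the letters scanned since the end of `u`; none of them
    -- affects `x₁` or `x₂`.
    suffices h : ∀ m : List A, (∀ b ∈ m, b ∉ B) →
        ((right (op x₁.out x₂.out) B fun _ => rewind R₁).run (m ++ u) s).out =
          op (x₁.run (m ++ u) s).out (x₂.run (m ++ u) s).out from h [] (by simp)
    induction s with
    | nil =>
      intro m _
      rw [run_nil isRight_right, run_nil hx₁, run_nil hx₂]
      rfl
    | cons a s ihs =>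
      intro m hm
      rw [run_cons isRight_right]
      by_cases ha : a ∈ B
      · rw [next, dif_pos ha, resume_rewind]
        have hne : (a :: (m ++ u)).reverse ≠ [] := by simp
        have hT' := hu.detect hT hm ha
        rw [hR₁.run_eq [] _ (m ++ u) a s rfl hne (by simp) hT', resume_rewind,
          (hG₂ _).run_eq [] _ (m ++ u) a s rfl hne (by simp) hT']
        -- The rerun from the left end agrees with continuing `x` by the single letter `a`, so the
        -- height bound applies to its result.
        have hy : ∀ P x : ScanProgram A, x.IsRight → (∀ b ∈ m, x.next b = x) →
            P.run [] u.reverse = x → P.run [] (a :: (m ++ u)).reverse = x.run (m ++ u) [a] := by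
          intro P x hx hb hP
          have : (a :: (m ++ u)).reverse = u.reverse ++ (m.reverse ++ [a]) := by simp
          rw [this, run_append, hP, run_append, run_eq_self hx (by simpa using hb)]
          simp
        have h₁ := hy P₁ x₁ hx₁ (fun b hb => not_not.1 fun h => hm b hb (Or.inl h)) hu₁
        have h₂ := hy P₂ x₂ hx₂ (fun b hb => not_not.1 fun h => hm b hb (Or.inr h)) hu₂
        obtain ⟨h₃, h₄⟩ := hG _ _ (isRight_run P₁ [] (a :: (m ++ u)).reverse)
          (isRight_run P₂ [] (a :: (m ++ u)).reverse)
          (by rw [h₁, h₂]; exact height_run_singleton_add_lt hx₁ hx₂ ha _)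
        rw [resume_of_isRight h₃, h₄ _ hT' rfl rfl, h₁, h₂,
          show a :: s = [a] ++ s from rfl, run_append, run_append]
        rfl
      · rw [next, dif_neg ha, resume_of_isRight isRight_right]
        obtain ⟨h₁, h₂⟩ := not_or.1 ha
        rw [not_not] at h₁ h₂
        rw [run_cons hx₁, h₁, run_cons hx₂, h₂, resume_of_isRight hx₁, resume_of_isRight hx₂]
        exact ihs (a :: m) (by simpa using ⟨ha, hm⟩)

/-- Programs are closed under Boolean operations on the output. -/
theorem exists_combine (op : Bool → Bool → Bool) (P₁ P₂ : ScanProgram A) :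
    ∃ R : ScanProgram A, ∀ w, (R.run [] w).out = op (P₁.run [] w).out (P₂.run [] w).out := by
  obtain ⟨R, -, hR⟩ := exists_combine_from op P₁ P₂ _ _ _ (isRight_run P₁ [] [])
    (isRight_run P₂ [] []) (Nat.lt_succ_self _)
    -- With one state and `T` everything, the first hit is the empty prefix.
    { State := PUnit, init := ⟨⟩, step := fun _ _ => ⟨⟩, le_step := fun _ _ => le_rfl }
    Set.univ isUpperSet_univ
  refine ⟨R, fun w => ?_⟩
  rw [hR [] ⟨trivial, fun l' h₁ h₂ => (h₂ (List.suffix_nil.1 h₁)).elim⟩ rfl rfl w]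
  have h : ∀ P : ScanProgram A, P.run [] w = (P.run [] []).run [] w := fun P => run_append P [] [] w
  rw [← h P₁, ← h P₂]

end ScanProgram

/-! ### From automata to programs -/

namespace TwoWayAutomaton

open ScanProgram

variable {A : Type u} {Z : Type v}

/-- `w` is accepted from the configuration `c`. -/
def AcceptsFrom (M : TwoWayAutomaton A Z) (w : List A) (c : Z × ℕ) : Prop :=
  ∃ z ∈ M.accept, Relation.ReflTransGen (M.Move w) c (z, w.length + 2)

theorem tape_zero (w : List A) : (tape w)[0]? = some .leftEnd := rfl

theorem tape_length_add_one (l : List A) : (tape l.reverse)[l.length + 1]? = some .rightEnd := by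
  rw [tape, List.getElem?_cons_succ, List.getElem?_append_right (by simp)]
  simp

theorem tape_letter (l : List A) (a : A) (r : List A) :
    (tape (l.reverse ++ a :: r))[l.length + 1]? = some (.letter a) := by
  rw [tape, List.getElem?_cons_succ, List.map_append, List.append_assoc,
    List.getElem?_append_right (by simp)]
  simp

theorem tape_length_add_two (w : List A) : (tape w)[w.length + 2]? = none := by
  simp [tape]

theorem not_move_of_eq (M : TwoWayAutomaton A Z) {w : List A} {z : Z} {c : Z × ℕ} :
    ¬ M.Move w (z, w.length + 2) c := by
  rintro ⟨a, ha, -⟩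
  rw [tape_length_add_two] at ha
  exact nomatch ha

theorem IsDeterministic.move_unique {M : TwoWayAutomaton A Z} (hM : M.IsDeterministic)
    {w : List A} {c c₁ c₂ : Z × ℕ} (h₁ : M.Move w c c₁) (h₂ : M.Move w c c₂) : c₁ = c₂ := by
  obtain ⟨a, ha, hs, hp⟩ := h₁
  obtain ⟨b, hb, hs', hp'⟩ := h₂
  obtain rfl : a = b := Option.some.inj (ha.symm.trans hb)
  have hz := hM.2 _ _ _ _ hs hs'
  rw [← hz] at hp'
  refine Prod.ext hz ?_
  rcases hp with hp | hp <;> rcases hp' with hp' | hp'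
  · exact hp.2.trans hp'.2.symm
  · exact absurd hp.1 hp'.1
  · exact absurd hp'.1 hp.1
  · exact Nat.succ.inj (hp.2.trans hp'.2.symm)

theorem IsDeterministic.acceptsFrom_iff_of_move {M : TwoWayAutomaton A Z}
    (hM : M.IsDeterministic) {w : List A} {c c' : Z × ℕ} (h : M.Move w c c') :
    M.AcceptsFrom w c ↔ M.AcceptsFrom w c' := by
  refine ⟨fun ⟨z, hz, hc⟩ => ⟨z, hz, ?_⟩, fun ⟨z, hz, hc⟩ => ⟨z, hz, hc.head h⟩⟩
  rcases hc.cases_head with rfl | ⟨c₁, h₁, h₂⟩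
  · exact (M.not_move_of_eq h).elim
  · rwa [← hM.move_unique h₁ h]

theorem not_acceptsFrom {M : TwoWayAutomaton A Z} {w : List A} {c : Z × ℕ} {a : TapeSymbol A}
    (ha : (tape w)[c.2]? = some a) (h : ∀ z, ¬ M.step c.1 a z) : ¬ M.AcceptsFrom w c := by
  rintro ⟨z, hz, hc⟩
  rcases hc.cases_head with rfl | ⟨c₁, ⟨b, hb, hs, -⟩, -⟩
  · rw [tape_length_add_two] at ha
    exact nomatch ha
  · obtain rfl : a = b := Option.some.inj (ha.symm.trans hb)
    exact h _ hs

/-- The states of `M` behave like the programs assigned to them. -/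
structure Simulates (M : TwoWayAutomaton A Z) (φ : Z → ScanProgram A) : Prop where
  isRight_iff : ∀ z, (φ z).IsRight ↔ z ∈ M.rightMoving
  letter : ∀ z a, (∃ z', M.step z (.letter a) z' ∧ φ z' = (φ z).next a) ∨
    (∀ z', ¬ M.step z (.letter a) z') ∧ (φ z).next a = halt false
  leftEnd : ∀ z ∉ M.rightMoving, (∃ z', M.step z .leftEnd z' ∧ φ z' = (φ z).bounce) ∨
    (∀ z', ¬ M.step z .leftEnd z') ∧ (φ z).bounce = halt false
  rightEnd : ∀ z ∈ M.rightMoving, (φ z).out = true ↔ M.step z .rightEnd z ∧ z ∈ M.accept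

/-- The position of the head in state `z` if `n` letters are to its left. -/
def headPosition (M : TwoWayAutomaton A Z) (z : Z) (n : ℕ) : ℕ :=
  if z ∈ M.rightMoving then n + 1 else n

/-- The step at a letter is the same for both head directions; the two hypotheses stand for the
induction hypotheses of `run_induction`. A missing transition rejects, as does `halt false`. -/
theorem Simulates.acceptsFrom_letter {M : TwoWayAutomaton A Z} {φ : Z → ScanProgram A}
    (h : M.Simulates φ) (hM : M.IsDeterministic) {l : List A} {a : A} {r : List A} {z : Z}
    (h₁ : ((φ z).next a).IsRight → ∀ z', φ z' = (φ z).next a →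
      (M.AcceptsFrom ((a :: l).reverse ++ r) (z', M.headPosition z' (a :: l).length) ↔
        (((φ z).next a).run (a :: l) r).out = true))
    (h₂ : ¬ ((φ z).next a).IsRight → ∀ z', φ z' = (φ z).next a →
      (M.AcceptsFrom (l.reverse ++ a :: r) (z', M.headPosition z' l.length) ↔
        (((φ z).next a).run l (a :: r)).out = true)) :
    M.AcceptsFrom (l.reverse ++ a :: r) (z, l.length + 1) ↔
      (((φ z).next a).resume l a r).out = true := by
  rcases h.letter z a with ⟨z', hs, hz'⟩ | ⟨hs, hz'⟩
  · by_cases hr : z' ∈ M.rightMoving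
    · have hR : ((φ z).next a).IsRight := by rwa [← hz', h.isRight_iff]
      have hmv : M.Move (l.reverse ++ a :: r) (z, l.length + 1) (z', l.length + 1 + 1) :=
        ⟨_, tape_letter l a r, hs, Or.inl ⟨hr, rfl⟩⟩
      have := h₁ hR z' hz'
      rw [headPosition, if_pos hr] at this
      rw [hM.acceptsFrom_iff_of_move hmv, resume_of_isRight hR, ← this]
      simp
    · have hR : ¬ ((φ z).next a).IsRight := by rwa [← hz', h.isRight_iff]
      have hmv : M.Move (l.reverse ++ a :: r) (z, l.length + 1) (z', l.length) :=
        ⟨_, tape_letter l a r, hs, Or.inr ⟨hr, rfl⟩⟩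
      have := h₂ hR z' hz'
      rw [headPosition, if_neg hr] at this
      rw [hM.acceptsFrom_iff_of_move hmv, resume_of_not_isRight hR, ← this]
  · rw [hz', resume_of_isRight (P := halt false) trivial, run_halt]
    exact iff_of_false (not_acceptsFrom (c := (z, l.length + 1)) (tape_letter l a r) hs)
      Bool.false_ne_true

theorem Simulates.acceptsFrom_iff {M : TwoWayAutomaton A Z} {φ : Z → ScanProgram A}
    (h : M.Simulates φ) (hM : M.IsDeterministic) (hM' : M.IsOnePass) (P : ScanProgram A)
    (l r : List A) : ∀ z, φ z = P →
      (M.AcceptsFrom (l.reverse ++ r) (z, M.headPosition z l.length) ↔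
        (P.run l r).out = true) := by
  induction P, l, r using run_induction with
  | right_nil P l hP =>
    rintro z rfl
    have hr := (h.isRight_iff z).1 hP
    rw [run_nil hP, h.rightEnd z hr, headPosition, if_pos hr, List.append_nil]
    by_cases hs : M.step z .rightEnd z
    · have hmv : M.Move l.reverse (z, l.length + 1) (z, l.length + 1 + 1) :=
        ⟨_, tape_length_add_one l, hs, Or.inl ⟨hr, rfl⟩⟩
      rw [hM.acceptsFrom_iff_of_move hmv]
      -- The loop at the right marker leads to position |w| + 2, where no move is possible, so `z`
      -- itself has to be final.
      refine ⟨fun ⟨z', hz', hc⟩ => ⟨hs, ?_⟩, fun hz => ⟨z, hz.2, by simp; rfl⟩⟩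
      rcases hc.cases_head with hc | ⟨c, hc, -⟩
      · rwa [(Prod.mk.inj hc).1]
      · have := M.not_move_of_eq (w := l.reverse) (z := z) (c := c)
        rw [List.length_reverse] at this
        exact (this hc).elim
    · refine iff_of_false (not_acceptsFrom (c := (z, l.length + 1)) (tape_length_add_one l) ?_)
        fun h => hs h.1
      intro z' hz'
      obtain rfl := hM' z z' hz'
      exact hs hz'
  | right_cons P l a r hP h₁ h₂ =>
    rintro z rfl
    rw [headPosition, if_pos ((h.isRight_iff z).1 hP), run_cons hP]
    exact h.acceptsFrom_letter hM h₁ h₂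
  | left_nil P r hP h₁ =>
    rintro z rfl
    have hr := mt (h.isRight_iff z).2 hP
    rw [headPosition, if_neg hr, run_left_nil]
    rcases h.leftEnd z hr with ⟨z', hs, hz'⟩ | ⟨hs, hz'⟩
    · have hr' := (M.step_leftEnd z z' hs).2
      have hmv : M.Move ([].reverse ++ r) (z, ([] : List A).length) (z', 1) :=
        ⟨_, tape_zero _, hs, Or.inl ⟨hr', rfl⟩⟩
      have := h₁ z' hz'
      rw [headPosition, if_pos hr'] at this
      rw [hM.acceptsFrom_iff_of_move hmv]
      exact this
    · rw [hz', run_halt]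
      exact iff_of_false (not_acceptsFrom (c := (z, 0)) (tape_zero _) hs) Bool.false_ne_true
  | left_cons P l a r hP h₁ h₂ =>
    rintro z rfl
    rw [headPosition, if_neg (mt (h.isRight_iff z).2 hP), run_left_cons hP,
      show (a :: l).reverse ++ r = l.reverse ++ a :: r by simp]
    exact h.acceptsFrom_letter hM h₁ h₂

theorem Simulates.mem_language_iff {M : TwoWayAutomaton A Z} {φ : Z → ScanProgram A}
    (h : M.Simulates φ) (hM : M.IsDeterministic) (hM' : M.IsOnePass) {z₀ : Z}
    (hz₀ : M.start = {z₀}) (w : List A) :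
    w ∈ M.language ↔ ((φ z₀).run [] w).out = true := by
  have hr : z₀ ∈ M.rightMoving := M.start_subset (hz₀ ▸ Set.mem_singleton z₀)
  rw [← h.acceptsFrom_iff hM hM' (φ z₀) [] w z₀ rfl, headPosition, if_pos hr]
  constructor
  · rintro ⟨z, hz, hc⟩
    rw [hz₀, Set.mem_singleton_iff] at hz
    exact hz ▸ hc
  · exact fun hc => ⟨z₀, hz₀ ▸ Set.mem_singleton z₀, hc⟩

/-- The program of the state `z`, obtained by unfolding the automaton. -/
def unfold (M : TwoWayAutomaton A Z) (lt : Z → Z → Prop) (hwf : WellFounded lt)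
    (hlt : ∀ z a z', M.step z a z' → ¬ M.step z a z → lt z' z) (z : Z) : ScanProgram A :=
  hwf.fix (fun z rec =>
    if hz : z ∈ M.rightMoving then
      ScanProgram.right (decide (M.step z .rightEnd z ∧ z ∈ M.accept)) {a | ¬ M.step z (.letter a) z}
        fun a => if h : ∃ z', M.step z (.letter a.1) z' then
          rec h.choose (hlt _ _ _ h.choose_spec a.2) else halt false
    else
      ScanProgram.left {a | ¬ M.step z (.letter a) z}
        (fun a => if h : ∃ z', M.step z (.letter a.1) z' then
          rec h.choose (hlt _ _ _ h.choose_spec a.2) else halt false)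
        (if h : ∃ z', M.step z .leftEnd z' then
          rec h.choose (hlt _ _ _ h.choose_spec
            fun h' => hz (M.step_leftEnd _ _ h').2) else halt false)) z

theorem simulates_unfold (M : TwoWayAutomaton A Z) (lt : Z → Z → Prop)
    (hwf : WellFounded lt) (hlt : ∀ z a z', M.step z a z' → ¬ M.step z a z → lt z' z) :
    M.Simulates (M.unfold lt hwf hlt) := by
  have hright : ∀ z, z ∈ M.rightMoving → M.unfold lt hwf hlt z =
      ScanProgram.right (decide (M.step z .rightEnd z ∧ z ∈ M.accept)) {a | ¬ M.step z (.letter a) z}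
        fun a => if h : ∃ z', M.step z (.letter a.1) z' then
          M.unfold lt hwf hlt h.choose else halt false := by
    intro z hz
    rw [unfold, hwf.fix_eq, dif_pos hz]
    rfl
  have hleft : ∀ z, z ∉ M.rightMoving → M.unfold lt hwf hlt z =
      ScanProgram.left {a | ¬ M.step z (.letter a) z}
        (fun a => if h : ∃ z', M.step z (.letter a.1) z' then
          M.unfold lt hwf hlt h.choose else halt false)
        (if h : ∃ z', M.step z .leftEnd z' then
          M.unfold lt hwf hlt h.choose else halt false) := by
    intro z hz
    rw [unfold, hwf.fix_eq, dif_neg hz]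
    rfl
  have hR : ∀ z, (M.unfold lt hwf hlt z).IsRight ↔ z ∈ M.rightMoving := by
    intro z
    by_cases hz : z ∈ M.rightMoving
    · rw [hright z hz]
      exact iff_of_true trivial hz
    · rw [hleft z hz]
      exact iff_of_false id hz
  have hnext : ∀ z a, ¬ M.step z (.letter a) z → (M.unfold lt hwf hlt z).next a =
      if h : ∃ z', M.step z (.letter a) z' then
        M.unfold lt hwf hlt h.choose else halt false := by
    intro z a ha
    by_cases hz : z ∈ M.rightMoving
    · rw [hright z hz]
      exact dif_pos ha
    · rw [hleft z hz]
      exact dif_pos ha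
  have hstay : ∀ z a, M.step z (.letter a) z →
      (M.unfold lt hwf hlt z).next a = M.unfold lt hwf hlt z := by
    intro z a ha
    by_cases hz : z ∈ M.rightMoving
    · rw [hright z hz]
      exact dif_neg (not_not.2 ha)
    · rw [hleft z hz]
      exact dif_neg (not_not.2 ha)
  refine ⟨hR, fun z a => ?_, fun z hz => ?_, fun z hz => ?_⟩
  · by_cases ha : M.step z (.letter a) z
    · exact Or.inl ⟨z, ha, (hstay z a ha).symm⟩
    · rw [hnext z a ha]
      by_cases h : ∃ z', M.step z (.letter a) z'
      · rw [dif_pos h]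
        exact Or.inl ⟨h.choose, h.choose_spec, rfl⟩
      · rw [dif_neg h]
        exact Or.inr ⟨not_exists.1 h, rfl⟩
  · rw [hleft z hz, bounce]
    by_cases h : ∃ z', M.step z .leftEnd z'
    · rw [dif_pos h, bounce_of_isRight ((hR _).2 (M.step_leftEnd _ _ h.choose_spec).2)]
      exact Or.inl ⟨h.choose, h.choose_spec, rfl⟩
    · rw [dif_neg h]
      exact Or.inr ⟨not_exists.1 h, rfl⟩
  · rw [hright z hz]
    exact decide_eq_true_iff

end TwoWayAutomaton

/-! ### From programs to automata -/

namespace ScanProgram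

open TwoWayAutomaton

variable {A : Type u}

/-- The language of the words on which the output of a program is `true`. -/
def language (P : ScanProgram A) : Language A := {w | (P.run [] w).out = true}

/-- `Q` is an immediate subprogram of `P`. -/
inductive Child : ScanProgram A → ScanProgram A → Prop
  | right (v : Bool) (exits : Set A) (f : exits → ScanProgram A) (a : exits) :
      Child (right v exits f) (f a)
  | left (exits : Set A) (f : exits → ScanProgram A) (q : ScanProgram A) (a : exits) :
      Child (left exits f q) (f a)
  | atLeft (exits : Set A) (f : exits → ScanProgram A) (q : ScanProgram A) :
      Child (left exits f q) q

theorem next_eq_or_child : ∀ (P : ScanProgram A) (a : A), P.next a = P ∨ Child P (P.next a)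
  | right v exits f, a => by
    by_cases h : a ∈ exits
    · right
      rw [next, dif_pos h]
      exact .right _ _ _ _
    · exact Or.inl (dif_neg h)
  | left exits f q, a => by
    by_cases h : a ∈ exits
    · right
      rw [next, dif_pos h]
      exact .left _ _ _ _
    · exact Or.inl (dif_neg h)

theorem reflTransGen_bounce : ∀ P : ScanProgram A, Relation.ReflTransGen Child P P.bounce
  | right _ _ _ => .refl
  | left _ _ q => .head (.atLeft _ _ _) (reflTransGen_bounce q)

/-- Programs are well-founded trees, finitely branching because the alphabet is finite. -/
theorem finite_reflTransGen_child [Finite A] (P : ScanProgram A) :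
    {Q | Relation.ReflTransGen Child P Q}.Finite := by
  induction P with
  | right v exits f ih =>
    refine ((Set.finite_singleton (right v exits f)).union (Set.finite_iUnion ih)).subset ?_
    intro Q hQ
    rcases Relation.ReflTransGen.cases_head hQ with h | ⟨P, ⟨⟩, h⟩
    · exact Or.inl h.symm
    · exact Or.inr (Set.mem_iUnion.2 ⟨_, h⟩)
  | left exits f q ih ihq =>
    refine ((Set.finite_singleton (left exits f q)).union
      ((Set.finite_iUnion ih).union ihq)).subset ?_
    intro Q hQ
    rcases Relation.ReflTransGen.cases_head hQ with h | ⟨P, ⟨⟩, h⟩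
    · exact Or.inl h.symm
    · exact Or.inr (Or.inl (Set.mem_iUnion.2 ⟨_, h⟩))
    · exact Or.inr (Or.inr h)

/-- The automaton whose states are the subprograms of `P`. -/
def toAutomaton (P : ScanProgram A) :
    TwoWayAutomaton A {Q : ScanProgram A // Relation.ReflTransGen Child P Q} where
  rightMoving := {z | z.1.IsRight}
  step z
    | .leftEnd, z' => ¬ z.1.IsRight ∧ z'.1 = z.1.bounce
    | .letter a, z' => z'.1 = z.1.next a
    | .rightEnd, z' => z.1.IsRight ∧ z' = z
  start := {⟨P.bounce, reflTransGen_bounce P⟩}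
  accept := {z | z.1.out = true}
  start_subset := Set.singleton_subset_iff.2 (isRight_bounce P)
  step_leftEnd z z' h := ⟨h.1, by
    rw [Set.mem_ofPred_eq, h.2]
    exact isRight_bounce _⟩
  step_rightEnd z z' h := h.1

theorem isDeterministic_toAutomaton (P : ScanProgram A) : P.toAutomaton.IsDeterministic := by
  refine ⟨Or.inl ⟨_, rfl, fun z hz => hz⟩, fun z a z₁ z₂ h₁ h₂ => Subtype.ext ?_⟩
  cases a with
  | leftEnd => exact h₁.2.trans h₂.2.symm
  | letter a => exact Eq.trans h₁ (Eq.symm h₂)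
  | rightEnd => rw [h₁.2, h₂.2]

theorem isOnePass_toAutomaton (P : ScanProgram A) : P.toAutomaton.IsOnePass :=
  fun _ _ h => h.2.symm

theorem isPartiallyOrdered_toAutomaton [Finite A] (P : ScanProgram A) :
    P.toAutomaton.IsPartiallyOrdered := by
  refine ⟨{
    le := fun z z' => z = z' ∨ z'.1.height < z.1.height
    le_refl := fun z => Or.inl rfl
    le_trans := ?_
    le_antisymm := ?_ }, fun z a z' h => ?_⟩
  · rintro x y z (rfl | h) (rfl | h')
    exacts [Or.inl rfl, Or.inr h', Or.inr h, Or.inr (h'.trans h)]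
  · rintro x y (rfl | h) (h' | h')
    exacts [rfl, rfl, h'.symm, absurd h h'.not_gt]
  · cases a with
    | leftEnd =>
      refine Or.inr ?_
      rw [h.2]
      exact height_bounce_lt h.1
    | letter a =>
      have h : z'.1 = z.1.next a := h
      rcases z.1.next_eq_or_height_lt a with h' | h'
      · exact Or.inl (Subtype.ext (h.trans h').symm)
      · exact Or.inr (h ▸ h')
    | rightEnd => exact Or.inl h.2.symm

theorem simulates_toAutomaton (P : ScanProgram A) : P.toAutomaton.Simulates Subtype.val where
  isRight_iff _ := Iff.rfl
  letter z a := by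
    refine Or.inl ⟨⟨z.1.next a, ?_⟩, rfl, rfl⟩
    rcases z.1.next_eq_or_child a with h | h
    · rw [h]
      exact z.2
    · exact z.2.tail h
  leftEnd z hz := Or.inl ⟨⟨z.1.bounce, z.2.trans (reflTransGen_bounce _)⟩, ⟨hz, rfl⟩, rfl⟩
  rightEnd z hz := ⟨fun h => ⟨⟨hz, rfl⟩, h⟩, fun h => h.2⟩

theorem isOnePassPo2dfaRecognizable_language [Finite A] (P : ScanProgram A) :
    IsOnePassPo2dfaRecognizable P.language := by
  refine ⟨_, (finite_reflTransGen_child P).to_subtype, P.toAutomaton,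
    isDeterministic_toAutomaton P, isPartiallyOrdered_toAutomaton P, isOnePass_toAutomaton P, ?_⟩
  -- The automaton starts in `P.bounce`, as initial states must be right-moving; at the left end
  -- this does not change the run.
  ext w
  rw [(simulates_toAutomaton P).mem_language_iff (isDeterministic_toAutomaton P)
    (isOnePass_toAutomaton P) rfl, ← run_left_nil]
  rfl

end ScanProgram

/-! ### Boolean closure of the recognizable languages -/

theorem isOnePassPo2dfaRecognizable_iff {A : Type u} [Finite A] {L : Language A} :
    IsOnePassPo2dfaRecognizable L ↔ ∃ P : ScanProgram A, P.language = L := by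
  constructor
  · rintro ⟨Z, _, M, hM, ⟨r, hr⟩, hM', rfl⟩
    rcases hM.1 with ⟨z₀, hz₀, huniq⟩ | hZ
    · have hwf : WellFounded fun z z' : Z => r.lt z' z := (inferInstance : WellFoundedGT Z).wf
      have hlt : ∀ z a z', M.step z a z' → ¬ M.step z a z → r.lt z z' := fun z a z' h h' =>
        lt_of_le_of_ne (hr z a z' h) fun e => h' (e ▸ h)
      refine ⟨M.unfold _ hwf hlt z₀, ?_⟩
      ext w
      exact ((M.simulates_unfold _ hwf hlt).mem_language_iff hM hM'
        (Set.eq_singleton_iff_unique_mem.2 ⟨hz₀, huniq⟩) w).symm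
    · refine ⟨.halt false, ?_⟩
      ext w
      refine iff_of_false ?_ ?_
      · change ¬ ((ScanProgram.halt false).run [] w).out = true
        rw [ScanProgram.run_halt]
        exact Bool.false_ne_true
      · rintro ⟨z, -⟩
        exact hZ.elim z
  · rintro ⟨P, rfl⟩
    exact P.isOnePassPo2dfaRecognizable_language

theorem IsOnePassPo2dfaRecognizable.combine {A : Type u} [Finite A] {L₁ L₂ L : Language A}
    (h₁ : IsOnePassPo2dfaRecognizable L₁) (h₂ : IsOnePassPo2dfaRecognizable L₂)
    (op : Bool → Bool → Bool)
    (h : ∀ w, w ∈ L ↔ op (decide (w ∈ L₁)) (decide (w ∈ L₂)) = true) :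
    IsOnePassPo2dfaRecognizable L := by
  rw [isOnePassPo2dfaRecognizable_iff] at *
  obtain ⟨P₁, rfl⟩ := h₁
  obtain ⟨P₂, rfl⟩ := h₂
  obtain ⟨R, hR⟩ := ScanProgram.exists_combine op P₁ P₂
  refine ⟨R, ?_⟩
  ext w
  have hP : ∀ P : ScanProgram A, decide (w ∈ P.language) = (P.run [] w).out := fun P =>
    Bool.decide_eq_true
  rw [h, hP, hP, ← hR]
  rfl

end

theorem mainTheorem4 {A : Type u} [Finite A] :
    ∃ B : BooleanSubalgebra (Language A),
      (B : Set (Language A)) = {L : Language A | IsOnePassPo2dfaRecognizable L} := by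
  classical
  refine ⟨{
    carrier := {L : Language A | IsOnePassPo2dfaRecognizable L}
    supClosed' := fun L₁ h₁ L₂ h₂ => h₁.combine h₂ or fun w => ?_
    infClosed' := fun L₁ h₁ L₂ h₂ => h₁.combine h₂ and fun w => ?_
    compl_mem' := fun {L} h => h.combine h (fun b _ => !b) fun w => ?_
    bot_mem' := isOnePassPo2dfaRecognizable_iff.2 ⟨.halt false, ?_⟩ }, rfl⟩
  · rw [Bool.or_eq_true, decide_eq_true_iff, decide_eq_true_iff]
    exact Iff.rfl
  · rw [Bool.and_eq_true, decide_eq_true_iff, decide_eq_true_iff]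
    exact Iff.rfl
  · rw [Bool.not_eq_true', decide_eq_false_iff_not]
    exact Iff.rfl
  · ext w
    refine iff_of_false ?_ id
    change ¬ ((ScanProgram.halt false).run [] w).out = true
    rw [ScanProgram.run_halt]
    exact Bool.false_ne_true
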